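/- Let $A$ be a (not necessarily unital) C*-algebra and let $C\subset A$ be an abelian $*$-subalgebra (not necessarily norm closed) which is regular, i.e. the normalizer $N_A(C)=\{n\in A : nCn^*\cup n^*Cn\subset C\}$ generates $A$ as a C*-algebra. Let $\pi\colon A\to\mathbb{B}(H)$ be a (not necessarily nondegenerate) $*$-representation on a complex Hilbert space $H$ such that the double commutant $\pi(A)''$ is a finite von Neumann algebra, i.e. every isometry in $\pi(A)''$ is unitary. Then $\pi(C)''$ is regular in $\pi(A)''$: writing $M=\pi(A)''$ and $N=\pi(C)''$, one has $N\subset M$ and $\{u\in U(M) : uNu^*=N\}''=M$, where $U(M)$ is the unitary group of $M$. In particular, if $\pi(A)''$ is a type II$_1$ factor, then $\pi(C)''$ is diffuse (i.e. has no minimal projections) or finite dimensional. -/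

import Mathlib

namespace RegularInclusion

section CStar

variable {A : Type*} [NonUnitalCStarAlgebra A]

/-- The normalizer `N_A(C) = {n ∈ A : n C n* ∪ n* C n ⊆ C}` of a `*`-subalgebra `C` of a
C*-algebra `A`. -/
def cstarNormalizer (C : NonUnitalStarSubalgebra ℂ A) : Set A :=
  {n | ∀ c ∈ C, n * c * star n ∈ C ∧ star n * c * n ∈ C}

/-- `C` is regular in the C*-algebra `A` if `N_A(C)` generates `A` as a C*-algebra. -/
def IsCStarRegular (C : NonUnitalStarSubalgebra ℂ A) : Prop :=
  (NonUnitalStarAlgebra.adjoin ℂ (cstarNormalizer C)).topologicalClosure = ⊤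

end CStar

section VonNeumann

variable {H : Type*} [NormedAddCommGroup H] [InnerProductSpace ℂ H] [CompleteSpace H]

/-- The double commutant `S''` in `B(H)` of a (possibly degenerate) `*`-subalgebra `S` of `B(H)`,
as a von Neumann algebra. -/
noncomputable def bicommutant (S : NonUnitalStarSubalgebra ℂ (H →L[ℂ] H)) :
    VonNeumannAlgebra H where
  carrier := Set.centralizer (Set.centralizer (S : Set (H →L[ℂ] H)))
  mul_mem' := Set.mul_mem_centralizer
  one_mem' := Set.one_mem_centralizer
  add_mem' := Set.add_mem_centralizer
  zero_mem' := Set.zero_mem_centralizer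
  algebraMap_mem' r := fun x _ => (Algebra.commutes r x).symm
  star_mem' := by
    have hS : ∀ x ∈ S, star x ∈ S := fun x hx => star_mem hx
    intro a ha x hx
    have hx' : star x ∈ Set.centralizer (S : Set (H →L[ℂ] H)) := by
      intro s hs
      have := hx (star s) (hS s hs)
      simpa using (congrArg star this).symm
    simpa using (congrArg star (ha (star x) hx')).symm
  centralizer_centralizer' := Set.centralizer_centralizer_centralizer _

/-- The normalizer `𝒩_M(N) = {u ∈ U(M) : u N u* = N}` of `N` in the von Neumann algebra `M`. -/
def vnNormalizer (M N : VonNeumannAlgebra H) : Set (H →L[ℂ] H) :=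
  {u | u ∈ M ∧ u ∈ unitary (H →L[ℂ] H) ∧
    (fun x => u * x * star u) '' (N : Set (H →L[ℂ] H)) = N}

/-- `N` is a regular von Neumann subalgebra of `M`: `N ⊆ M` and `𝒩_M(N)'' = M`. -/
def IsVNRegular (M N : VonNeumannAlgebra H) : Prop :=
  N ≤ M ∧ Set.centralizer (Set.centralizer (vnNormalizer M N)) = (M : Set (H →L[ℂ] H))

/-- A von Neumann algebra is finite if each of its isometries is unitary. -/
def IsFiniteVN (M : VonNeumannAlgebra H) : Prop :=
  ∀ v ∈ M, star v * v = 1 → v * star v = 1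

/-- A nonzero von Neumann algebra with trivial center. -/
def IsFactor (M : VonNeumannAlgebra H) : Prop :=
  Nontrivial H ∧ ∀ z ∈ M, (∀ x ∈ M, z * x = x * z) → ∃ c : ℂ, z = c • (1 : H →L[ℂ] H)

/-- `p` is an abelian projection of `M`: the corner `pMp` is commutative. -/
def IsAbelianProjection (M : VonNeumannAlgebra H) (p : H →L[ℂ] H) : Prop :=
  p ∈ M ∧ IsStarProjection p ∧
    ∀ x ∈ M, ∀ y ∈ M, (p * x * p) * (p * y * p) = (p * y * p) * (p * x * p)

/-- A factor of type II₁: a finite factor without nonzero abelian projections. -/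
def IsTypeII1Factor (M : VonNeumannAlgebra H) : Prop :=
  IsFactor M ∧ IsFiniteVN M ∧ ∀ p, IsAbelianProjection M p → p = 0

/-- `p` is minimal among the nonzero projections of `N`; `q * p = q` says `q ≤ p`. -/
def IsMinimalProjection (N : VonNeumannAlgebra H) (p : H →L[ℂ] H) : Prop :=
  p ∈ N ∧ IsStarProjection p ∧ p ≠ 0 ∧
    ∀ q ∈ N, IsStarProjection q → q * p = q → q = 0 ∨ q = p

/-- A von Neumann algebra is diffuse if it has no minimal projections. -/
def IsDiffuse (N : VonNeumannAlgebra H) : Prop :=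
  ∀ p, ¬ IsMinimalProjection N p

end VonNeumann

end RegularInclusion

namespace RegularInclusion

set_option linter.unusedSectionVars false

variable {H : Type*} [NormedAddCommGroup H] [InnerProductSpace ℂ H] [CompleteSpace H]

/-! ### Kernel projections -/

/-- The orthogonal projection onto a closed subspace commutes with every operator that leaves the
subspace invariant together with its adjoint. -/
theorem commute_starProjection {K : Submodule ℂ H} [K.HasOrthogonalProjection] {y : H →L[ℂ] H}
    (hy : ∀ ξ ∈ K, y ξ ∈ K) (hy' : ∀ ξ ∈ K, star y ξ ∈ K) : Commute K.starProjection y := by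
  have key : ∀ w : H →L[ℂ] H, (∀ ξ ∈ K, w ξ ∈ K) →
      K.starProjection * w * K.starProjection = w * K.starProjection := by
    intro w hw
    ext ξ
    exact Submodule.starProjection_eq_self_iff.2 (hw _ (K.starProjection_apply_mem ξ))
  have hP : star K.starProjection = K.starProjection := isSelfAdjoint_starProjection K
  have h1 := key y hy
  have h2 := congrArg star (key (star y) hy')
  simp only [star_mul, star_star, hP] at h2
  rw [← mul_assoc] at h2
  exact h2.symm.trans h1

/-- The orthogonal projection onto the kernel of a bounded operator. -/
noncomputable def kerProj (x : H →L[ℂ] H) : H →L[ℂ] H := x.ker.starProjection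

theorem isStarProjection_kerProj (x : H →L[ℂ] H) : IsStarProjection (kerProj x) :=
  isStarProjection_starProjection

theorem star_kerProj (x : H →L[ℂ] H) : star (kerProj x) = kerProj x :=
  (isStarProjection_kerProj x).isSelfAdjoint

theorem kerProj_mul_self (x : H →L[ℂ] H) : kerProj x * kerProj x = kerProj x :=
  (isStarProjection_kerProj x).isIdempotentElem

theorem mul_kerProj (x : H →L[ℂ] H) : x * kerProj x = 0 := by
  ext ξ
  exact LinearMap.mem_ker.1 (x.ker.starProjection_apply_mem ξ)

theorem kerProj_mul (x : H →L[ℂ] H) (hx : star x = x) : kerProj x * x = 0 := by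
  have := congrArg star (mul_kerProj x)
  simpa [star_kerProj, hx] using this

theorem kerProj_mul_of_mul_eq_zero {x w : H →L[ℂ] H} (h : x * w = 0) : kerProj x * w = w := by
  ext ξ
  refine Submodule.starProjection_eq_self_iff.2 (LinearMap.mem_ker.2 ?_)
  exact DFunLike.congr_fun h ξ

theorem commute_kerProj {x y : H →L[ℂ] H} (h : Commute x y) (h' : Commute x (star y)) :
    Commute (kerProj x) y := by
  refine commute_starProjection (fun ξ hξ => ?_) (fun ξ hξ => ?_) <;>
    rw [LinearMap.mem_ker] at hξ ⊢
  · have := DFunLike.congr_fun h.eq ξ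
    simp only [mul_apply_eq_comp] at this
    exact this.trans (by erw [hξ]; simp)
  · have := DFunLike.congr_fun h'.eq ξ
    simp only [mul_apply_eq_comp] at this
    exact this.trans (by erw [hξ]; simp)

theorem eq_zero_of_star_mul_self {x : H →L[ℂ] H} (h : star x * x = 0) : x = 0 :=
  CStarRing.star_mul_self_eq_zero_iff x |>.1 h

/-! ### Density of projections in commutants -/

theorem _root_.IsStarProjection.mul_nonneg_of_commute {E x : H →L[ℂ] H} (hE : IsStarProjection E)
    (hc : Commute E x) (hx : 0 ≤ x) : 0 ≤ E * x := by
  have h := star_left_conjugate_nonneg hx E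
  rw [hE.isSelfAdjoint.star_eq, mul_assoc, ← hc.eq, ← mul_assoc, hE.isIdempotentElem.eq] at h
  exact h

section Commutant

variable {Y : Set (H →L[ℂ] H)}

theorem star_mem_commutant (hY : ∀ y ∈ Y, star y ∈ Y) {x : H →L[ℂ] H} (hx : x ∈ Y.centralizer) :
    star x ∈ Y.centralizer := by
  intro y hy
  have := congrArg star (hx (star y) (hY y hy))
  simpa using this.symm

theorem kerProj_mem_commutant (hY : ∀ y ∈ Y, star y ∈ Y) {x : H →L[ℂ] H}
    (hx : x ∈ Y.centralizer) : kerProj x ∈ Y.centralizer := fun y hy =>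
  (commute_kerProj (hx y hy).symm (hx _ (hY y hy)).symm).eq.symm

theorem posPart_mem_commutant {x : H →L[ℂ] H} (hx : x ∈ Y.centralizer) :
    x⁺ ∈ Y.centralizer := fun y hy =>
  (Commute.cfcₙ_real (show Commute x y from (hx y hy).symm) _).eq.symm

theorem negPart_mem_commutant {x : H →L[ℂ] H} (hx : x ∈ Y.centralizer) :
    x⁻ ∈ Y.centralizer := fun y hy =>
  (Commute.cfcₙ_real (show Commute x y from (hx y hy).symm) _).eq.symm

theorem smul_mem_commutant {x : H →L[ℂ] H} (c : ℂ) (hx : x ∈ Y.centralizer) :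
    c • x ∈ Y.centralizer := fun y hy => by
  rw [mul_smul_comm, smul_mul_assoc, hx y hy]

theorem sub_mem_commutant {x x' : H →L[ℂ] H} (hx : x ∈ Y.centralizer)
    (hx' : x' ∈ Y.centralizer) : x - x' ∈ Y.centralizer := by
  rw [sub_eq_add_neg]
  exact Set.add_mem_centralizer hx (Set.neg_mem_centralizer hx')

/-- First binary digit of a positive contraction in a von Neumann algebra. -/
theorem exists_projection_dyadic (hY : ∀ y ∈ Y, star y ∈ Y) {x : H →L[ℂ] H}
    (hx : x ∈ Y.centralizer) (h0 : 0 ≤ x) (h1 : x ≤ 1) :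
    ∃ E ∈ Y.centralizer, IsStarProjection E ∧ 0 ≤ 2 * x - E ∧ 2 * x - E ≤ 1 := by
  set b : H →L[ℂ] H := 2 * x - 1 with hb
  have h1Y : (1 : H →L[ℂ] H) ∈ Y.centralizer := Set.one_mem_centralizer
  have hbY : b ∈ Y.centralizer := by
    rw [hb, two_mul]; exact sub_mem_commutant (Set.add_mem_centralizer hx hx) h1Y
  have hxsa : IsSelfAdjoint x := h0.isSelfAdjoint
  have hbsa : IsSelfAdjoint b := by
    rw [hb, two_mul]; exact (hxsa.add hxsa).sub (.one _)
  have hbp := posPart_mem_commutant hbY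
  have hbps : star b⁺ = b⁺ := (CFC.posPart_nonneg b).isSelfAdjoint
  have hbdec := CFC.posPart_sub_negPart b hbsa
  set g := kerProj b⁺ with hg
  have hgY : g ∈ Y.centralizer := kerProj_mem_commutant hY hbp
  have hgp : IsStarProjection g := isStarProjection_kerProj _
  have hEp : IsStarProjection (1 - g) := hgp.one_sub
  have g1 : g * b⁺ = 0 := kerProj_mul _ hbps
  have g2 : b⁺ * g = 0 := mul_kerProj _
  have g3 : g * b⁻ = b⁻ := kerProj_mul_of_mul_eq_zero (CFC.posPart_mul_negPart b)
  have g4 : b⁻ * g = b⁻ := by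
    have := congrArg star g3
    rwa [star_mul, hgp.isSelfAdjoint.star_eq, (CFC.negPart_nonneg b).isSelfAdjoint.star_eq] at this
  have hxb : 2 * x = 1 + b⁺ - b⁻ := by rw [add_sub_assoc, hbdec, hb]; abel
  have hgx : Commute g (2 * x) := by
    rw [hxb]
    simp only [commute_iff_eq, mul_sub, mul_add, sub_mul, add_mul, g1, g2, g3, g4, mul_one, one_mul]
  have h2x0 : 0 ≤ 2 * x := by rw [two_mul]; exact add_nonneg h0 h0
  have h2x1 : 0 ≤ 2 - 2 * x := by
    have : (2 : H →L[ℂ] H) - 2 * x = (1 - x) + (1 - x) := by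
      rw [two_mul, ← one_add_one_eq_two]; abel
    rw [this]; exact add_nonneg (sub_nonneg.2 h1) (sub_nonneg.2 h1)
  refine ⟨1 - g, sub_mem_commutant h1Y hgY, hEp, ?_, ?_⟩
  · have : 2 * x - (1 - g) = g * (2 * x) + b⁺ := by
      rw [hxb]; simp only [mul_sub, mul_add, g1, g3, mul_one]; abel
    rw [this]
    exact add_nonneg (hgp.mul_nonneg_of_commute hgx h2x0) (CFC.posPart_nonneg b)
  · have : 1 - (2 * x - (1 - g)) = (1 - g) * (2 - 2 * x) + b⁻ := by
      rw [hxb, ← one_add_one_eq_two]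
      simp only [sub_mul, mul_sub, mul_add, g1, g3, mul_one, one_mul]; abel
    rw [← sub_nonneg, this]
    refine add_nonneg (hEp.mul_nonneg_of_commute ?_ h2x1) (CFC.negPart_nonneg b)
    have hg2 : Commute g (2 - 2 * x) := .sub_right (Commute.ofNat_right _ _) hgx
    exact (Commute.one_left _).sub_left hg2

theorem exists_norm_sub_le_of_projections_mem (hY : ∀ y ∈ Y, star y ∈ Y)
    (W : Submodule ℂ (H →L[ℂ] H)) (hW : ∀ p ∈ Y.centralizer, IsStarProjection p → p ∈ W) (n : ℕ) :
    ∀ x ∈ Y.centralizer, 0 ≤ x → x ≤ 1 → ∃ w ∈ W, ‖x - w‖ ≤ (1 / 2) ^ n := by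
  induction n with
  | zero =>
    intro x _ h0 h1
    exact ⟨0, W.zero_mem, by simpa using CStarAlgebra.norm_le_one_iff_of_nonneg x h0 |>.2 h1⟩
  | succ n ih =>
    intro x hx h0 h1
    obtain ⟨E, hE, hEp, hE0, hE1⟩ := exists_projection_dyadic hY hx h0 h1
    have hmem : 2 * x - E ∈ Y.centralizer := by
      rw [two_mul]; exact sub_mem_commutant (Set.add_mem_centralizer hx hx) hE
    obtain ⟨w, hw, hwn⟩ := ih _ hmem hE0 hE1
    refine ⟨(1 / 2 : ℂ) • (E + w), W.smul_mem _ (W.add_mem (hW E hE hEp) hw), ?_⟩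
    have : x - (1 / 2 : ℂ) • (E + w) = (1 / 2 : ℂ) • (2 * x - E - w) := by
      rw [two_mul]; module
    rw [this, norm_smul, pow_succ, mul_comm]
    refine mul_le_mul hwn (by simp) (by positivity) (by positivity)

/-- A norm-closed subspace containing every projection of a von Neumann algebra contains the
algebra. -/
theorem commutant_subset_of_projections_mem (hY : ∀ y ∈ Y, star y ∈ Y)
    (W : Submodule ℂ (H →L[ℂ] H)) (hWc : IsClosed (W : Set (H →L[ℂ] H)))
    (hW : ∀ p ∈ Y.centralizer, IsStarProjection p → p ∈ W) : Y.centralizer ⊆ W := by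
  have h01 : ∀ x ∈ Y.centralizer, 0 ≤ x → x ≤ 1 → x ∈ W := by
    intro x hx h0 h1
    refine hWc.closure_subset (Metric.mem_closure_iff.2 fun ε hε => ?_)
    obtain ⟨n, hn⟩ := exists_pow_lt_of_lt_one hε (by norm_num : (1 / 2 : ℝ) < 1)
    obtain ⟨w, hw, hwn⟩ := exists_norm_sub_le_of_projections_mem hY W hW n x hx h0 h1
    exact ⟨w, hw, by rw [dist_eq_norm]; exact hwn.trans_lt hn⟩
  have hpos : ∀ x ∈ Y.centralizer, 0 ≤ x → x ∈ W := by
    intro x hx h0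
    rcases eq_or_ne x 0 with rfl | hne
    · exact W.zero_mem
    have hn : 0 < ‖x‖ := norm_pos_iff.2 hne
    have hsm : ((‖x‖⁻¹ : ℝ) : ℂ) • x = (‖x‖⁻¹ : ℝ) • x :=
      Complex.coe_smul _ _
    have h0' : 0 ≤ ((‖x‖⁻¹ : ℝ) : ℂ) • x := by
      rw [hsm]; exact smul_nonneg (by positivity) h0
    have hmem := h01 _ (smul_mem_commutant ((‖x‖⁻¹ : ℝ) : ℂ) hx) h0'
      ((CStarAlgebra.norm_le_one_iff_of_nonneg _ h0').1 (by
        rw [norm_smul]; simp [hn.ne']))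
    have := W.smul_mem (‖x‖ : ℂ) hmem
    rwa [smul_smul, ← Complex.ofReal_mul, mul_inv_cancel₀ hn.ne', Complex.ofReal_one,
      one_smul] at this
  have hsa : ∀ x ∈ Y.centralizer, IsSelfAdjoint x → x ∈ W := by
    intro x hx hs
    rw [← CFC.posPart_sub_negPart x hs]
    exact W.sub_mem (hpos _ (posPart_mem_commutant hx) (CFC.posPart_nonneg x))
      (hpos _ (negPart_mem_commutant hx) (CFC.negPart_nonneg x))
  intro x hx
  have hxs := star_mem_commutant hY hx
  have h1 : x + star x ∈ W := hsa _ (Set.add_mem_centralizer hx hxs) (IsSelfAdjoint.add_star_self x)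
  have h2 : Complex.I • (x - star x) ∈ W :=
    hsa _ (smul_mem_commutant _ (sub_mem_commutant hx hxs)) (by
      rw [isSelfAdjoint_iff, star_smul, star_sub, star_star, RCLike.star_def, Complex.conj_I]
      module)
  have h3 := W.add_mem (W.smul_mem (1 / 2 : ℂ) h1) (W.smul_mem (-Complex.I / 2) h2)
  rw [smul_smul, show -Complex.I / 2 * Complex.I = 1 / 2 by
    rw [div_mul_eq_mul_div, neg_mul, Complex.I_mul_I]; norm_num] at h3
  rw [show (1 / 2 : ℂ) • (x + star x) + (1 / 2 : ℂ) • (x - star x) = x by module] at h3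
  exact h3

end Commutant

theorem isClosed_commutant_singleton (T : H →L[ℂ] H) :
    IsClosed ((Subalgebra.centralizer ℂ {T}).toSubmodule : Set (H →L[ℂ] H)) :=
  Set.isClosed_centralizer _

/-- An operator commuting with the projections of a von Neumann algebra commutes with it. -/
theorem commute_of_commute_projections {Y : Set (H →L[ℂ] H)} (hY : ∀ y ∈ Y, star y ∈ Y)
    {T : H →L[ℂ] H} (h : ∀ p ∈ Y.centralizer, IsStarProjection p → Commute T p)
    {x : H →L[ℂ] H} (hx : x ∈ Y.centralizer) : Commute T x := by
  have := commutant_subset_of_projections_mem hY (Subalgebra.centralizer ℂ {T}).toSubmodule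
    (isClosed_commutant_singleton T)
    (fun p hp hpp => Subalgebra.mem_centralizer_iff ℂ |>.2 (by
      rintro _ rfl; exact (h p hp hpp).eq)) hx
  exact Subalgebra.mem_centralizer_iff ℂ |>.1 this T rfl


/-! ### Von Neumann algebras as commutants -/

section VonNeumann

variable (N : VonNeumannAlgebra H)

theorem mem_iff_mem_centralizer_commutant {x : H →L[ℂ] H} :
    x ∈ N ↔ x ∈ (N.commutant : Set (H →L[ℂ] H)).centralizer := by
  rw [VonNeumannAlgebra.coe_commutant, VonNeumannAlgebra.centralizer_centralizer, SetLike.mem_coe]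

theorem star_mem_coe_commutant : ∀ y ∈ (N.commutant : Set (H →L[ℂ] H)), star y ∈
    (N.commutant : Set (H →L[ℂ] H)) := fun _ hy => star_mem (S := VonNeumannAlgebra H) hy

variable {N}

theorem mem_of_commute_commutant {x : H →L[ℂ] H} (h : ∀ y ∈ N.commutant, Commute y x) : x ∈ N :=
  (mem_iff_mem_centralizer_commutant N).2 fun y hy => (h y hy).eq

theorem commute_of_mem_commutant {x y : H →L[ℂ] H} (hx : x ∈ N) (hy : y ∈ N.commutant) :
    Commute x y :=
  VonNeumannAlgebra.mem_commutant_iff.1 hy x hx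

theorem mem_commutant_of_commute {y : H →L[ℂ] H} (h : ∀ x ∈ N, Commute x y) : y ∈ N.commutant :=
  VonNeumannAlgebra.mem_commutant_iff.2 fun x hx => (h x hx).eq

theorem kerProj_mem {x : H →L[ℂ] H} (hx : x ∈ N) : kerProj x ∈ N :=
  (mem_iff_mem_centralizer_commutant N).2 <| kerProj_mem_commutant (star_mem_coe_commutant N)
    ((mem_iff_mem_centralizer_commutant N).1 hx)

theorem negPart_mem {x : H →L[ℂ] H} (hx : x ∈ N) : x⁻ ∈ N :=
  (mem_iff_mem_centralizer_commutant N).2 <| negPart_mem_commutant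
    ((mem_iff_mem_centralizer_commutant N).1 hx)

theorem abs_mem_of_star_mul_self_mem {x : H →L[ℂ] H} (hx : star x * x ∈ N) : CFC.abs x ∈ N :=
  mem_of_commute_commutant fun _ hy =>
    (Commute.cfcₙ_nnreal (commute_of_mem_commutant hx hy) _).symm

theorem commute_of_commute_projections_mem {T : H →L[ℂ] H}
    (h : ∀ p ∈ N, IsStarProjection p → Commute T p) {x : H →L[ℂ] H} (hx : x ∈ N) : Commute T x :=
  commute_of_commute_projections (star_mem_coe_commutant N)
    (fun p hp => h p ((mem_iff_mem_centralizer_commutant N).2 hp))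
    ((mem_iff_mem_centralizer_commutant N).1 hx)

theorem mem_submodule_of_projections_mem (W : Submodule ℂ (H →L[ℂ] H))
    (hWc : IsClosed (W : Set (H →L[ℂ] H))) (h : ∀ p ∈ N, IsStarProjection p → p ∈ W)
    {x : H →L[ℂ] H} (hx : x ∈ N) : x ∈ W :=
  commutant_subset_of_projections_mem (star_mem_coe_commutant N) W hWc
    (fun p hp => h p ((mem_iff_mem_centralizer_commutant N).2 hp))
    ((mem_iff_mem_centralizer_commutant N).1 hx)

end VonNeumann

/-! ### Normalizing operators -/

section Normalizing

variable {M N : VonNeumannAlgebra H}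

/-- The symmetry `2p - 1`, with `p` the spectral projection of the self-adjoint operator `z` for
`[0, ∞)`. -/
noncomputable def signSymm (z : H →L[ℂ] H) : H →L[ℂ] H := 2 * kerProj z⁻ - 1

theorem star_signSymm (z : H →L[ℂ] H) : star (signSymm z) = signSymm z := by
  simp [signSymm, two_mul, star_kerProj]

theorem signSymm_mul_self (z : H →L[ℂ] H) : signSymm z * signSymm z = 1 := by
  simp only [signSymm, two_mul, sub_mul, mul_sub, add_mul, mul_add, kerProj_mul_self, mul_one,
    one_mul]
  abel

theorem signSymm_mul_abs {z : H →L[ℂ] H} (hz : IsSelfAdjoint z) : signSymm z * CFC.abs z = z := by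
  have h1 : kerProj z⁻ * z⁺ = z⁺ := kerProj_mul_of_mul_eq_zero (CFC.negPart_mul_posPart z)
  have h2 : kerProj z⁻ * z⁻ = 0 := kerProj_mul _ (CFC.negPart_nonneg z).isSelfAdjoint
  conv_rhs => rw [← CFC.posPart_sub_negPart z hz]
  rw [← CFC.posPart_add_negPart z hz]
  simp only [signSymm, two_mul, sub_mul, add_mul, mul_add, h1, h2, one_mul]
  abel

theorem abs_mul_signSymm {z : H →L[ℂ] H} (hz : IsSelfAdjoint z) : CFC.abs z * signSymm z = z := by
  have := congrArg star (signSymm_mul_abs hz)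
  rwa [star_mul, star_signSymm, (CFC.abs_nonneg z).isSelfAdjoint.star_eq, hz.star_eq] at this

theorem signSymm_mem {z : H →L[ℂ] H} (hz : z ∈ M) : signSymm z ∈ M := by
  rw [signSymm, two_mul]
  exact sub_mem (add_mem (kerProj_mem (negPart_mem hz)) (kerProj_mem (negPart_mem hz))) (one_mem M)

theorem signSymm_mul_kerProj_abs {z : H →L[ℂ] H} (hz : IsSelfAdjoint z) :
    signSymm z * kerProj (CFC.abs z) = kerProj (CFC.abs z) := by
  have hn : star z⁻ = z⁻ := (CFC.negPart_nonneg z).isSelfAdjoint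
  have h1 : z⁻ * CFC.abs z = z⁻ * z⁻ := by
    rw [← CFC.posPart_add_negPart z hz, mul_add, CFC.negPart_mul_posPart, zero_add]
  have h2 : z⁻ * kerProj (CFC.abs z) = 0 := by
    apply eq_zero_of_star_mul_self
    rw [star_mul, hn, mul_assoc, ← mul_assoc z⁻ z⁻, ← h1, mul_assoc, mul_kerProj, mul_zero,
      mul_zero]
  rw [signSymm, two_mul, sub_mul, add_mul, kerProj_mul_of_mul_eq_zero h2, one_mul]
  abel

theorem signSymm_conj_mem (hN : ∀ x ∈ N, ∀ y ∈ N, Commute x y) {z : H →L[ℂ] H}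
    (hz : IsSelfAdjoint z) (hzN : ∀ x ∈ N, z * x * z ∈ N) {x : H →L[ℂ] H} (hx : x ∈ N) :
    signSymm z * x * signSymm z ∈ N := by
  have hz2 : star z * z ∈ N := by
    rw [hz.star_eq]
    have := hzN 1 (one_mem N)
    rwa [mul_one] at this
  set b := CFC.abs z with hb
  set u := signSymm z with hu
  have hbN : b ∈ N := abs_mem_of_star_mul_self_mem hz2
  have hbs : star b = b := (CFC.abs_nonneg z).isSelfAdjoint
  set g := kerProj b with hg
  have hgN : g ∈ N := kerProj_mem hbN
  have hgs : star g = g := star_kerProj b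
  have hub : u * b = z := signSymm_mul_abs hz
  have hbu : b * u = z := abs_mul_signSymm hz
  have hug : u * g = g := signSymm_mul_kerProj_abs hz
  have hus : star u = u := star_signSymm z
  have hgu : g * u = g := by
    have := congrArg star hug
    rwa [star_mul, hus, hgs] at this
  refine mem_of_commute_commutant fun y hy => ?_
  have hyb := commute_of_mem_commutant hbN hy
  have hyg := commute_of_mem_commutant hgN hy
  have hyx := commute_of_mem_commutant hx hy
  have hgx := hN g hgN x hx
  set X := u * x * u with hX
  have hgX : g * X = x * g := by
    rw [hX, ← mul_assoc, ← mul_assoc, hgu, hgx.eq, mul_assoc, hgu]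
  have hXg : X * g = x * g := by
    rw [hX, mul_assoc, hug, mul_assoc, ← hgx.eq, ← mul_assoc, hug]
  set W := y * X - X * y with hW
  have hbX : b * X * b = z * x * z := by
    calc b * X * b = (b * u) * x * (u * b) := by rw [hX]; simp only [mul_assoc]
      _ = z * x * z := by rw [hbu, hub]
  have hzxz := commute_of_mem_commutant (hzN x hx) hy
  have hbW : b * (W * b) = 0 := by
    have e1 : b * (W * b) = y * (b * X * b) - b * X * b * y := by
      rw [hW, sub_mul, mul_sub, mul_assoc y, ← mul_assoc b y, mul_assoc X y, ← hyb.eq,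
        mul_assoc b X b, ← mul_assoc y, ← hyb.eq]
      simp only [mul_assoc]
    rw [e1, hbX, hzxz.eq, sub_self]
  have hgW : g * W = 0 := by
    rw [hW, mul_sub, ← mul_assoc, hyg.eq, mul_assoc, hgX, ← mul_assoc g, hgX, mul_assoc x,
      hyg.eq, ← mul_assoc, ← mul_assoc, hyx.eq, sub_self]
  have hWg : W * g = 0 := by
    rw [hW, sub_mul, mul_assoc, hXg, mul_assoc, ← hyg.eq, ← mul_assoc, ← mul_assoc, hXg,
      mul_assoc x, hyg.eq, ← mul_assoc, hyx.eq, sub_self]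
  have hWb : W * b = 0 := by
    have := kerProj_mul_of_mul_eq_zero hbW
    rw [← this, ← mul_assoc, ← hg, hgW, zero_mul]
  have hW0 : star W = 0 := by
    have h1 : b * star W = 0 := by
      have := congrArg star hWb
      rwa [star_mul, hbs, star_zero] at this
    have h2 : g * star W = 0 := by
      have := congrArg star hWg
      rwa [star_mul, hgs, star_zero] at this
    rw [← kerProj_mul_of_mul_eq_zero h1, ← hg, h2]
  exact sub_eq_zero.1 (star_eq_zero.1 hW0)

theorem mem_vnNormalizer_of_mem_commutant {u : H →L[ℂ] H} (hu : u ∈ M)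
    (huu : u ∈ unitary (H →L[ℂ] H)) (huN : u ∈ N.commutant) : u ∈ vnNormalizer M N := by
  refine ⟨hu, huu, ?_⟩
  have h : ∀ x ∈ N, u * x * star u = x := fun x hx => by
    rw [← (commute_of_mem_commutant hx huN).eq, mul_assoc, huu.2, mul_one]
  ext x
  constructor
  · rintro ⟨w, hw, rfl⟩
    simpa only [h w hw] using hw
  · exact fun hx => ⟨x, hx, h x hx⟩

theorem mem_vnNormalizer_of_symm {u : H →L[ℂ] H} (hu : u ∈ M) (hus : star u = u)
    (huu : u * u = 1) (huN : ∀ x ∈ N, u * x * u ∈ N) : u ∈ vnNormalizer M N := by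
  refine ⟨hu, ⟨by rw [hus, huu], by rw [hus, huu]⟩, ?_⟩
  ext x
  simp only [hus]
  constructor
  · rintro ⟨w, hw, rfl⟩
    exact huN w hw
  · refine fun hx => ⟨u * x * u, huN x hx, ?_⟩
    calc u * (u * x * u) * u = (u * u) * x * (u * u) := by simp only [mul_assoc]
      _ = x := by rw [huu, one_mul, mul_one]

variable {T : H →L[ℂ] H}

theorem commute_of_mem_relativeCommutant (hT : ∀ u ∈ vnNormalizer M N, Commute T u)
    {x : H →L[ℂ] H} (hx : x ∈ M) (hxN : x ∈ N.commutant) : Commute T x := by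
  have hY : ∀ y ∈ (M.commutant : Set (H →L[ℂ] H)) ∪ N,
      star y ∈ (M.commutant : Set (H →L[ℂ] H)) ∪ N := by
    rintro y (hy | hy)
    · exact .inl (star_mem_coe_commutant M y hy)
    · exact .inr (star_mem (S := VonNeumannAlgebra H) hy)
  have hmem : ∀ w : H →L[ℂ] H, w ∈ ((M.commutant : Set (H →L[ℂ] H)) ∪ N).centralizer ↔
      w ∈ M ∧ w ∈ N.commutant := fun w => by
    rw [Set.centralizer_union, Set.mem_inter_iff, ← mem_iff_mem_centralizer_commutant,
      ← VonNeumannAlgebra.coe_commutant, SetLike.mem_coe]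
  refine commute_of_commute_projections hY (fun p hp hpp => ?_) ((hmem x).2 ⟨hx, hxN⟩)
  obtain ⟨hpM, hpN⟩ := (hmem p).1 hp
  have hps := hpp.isSelfAdjoint.star_eq
  have hpi := hpp.isIdempotentElem.eq
  have hu : star (1 - 2 * p) = 1 - 2 * p := by simp [two_mul, hps]
  have hu2 : (1 - 2 * p) * (1 - 2 * p) = 1 := by
    simp only [two_mul, sub_mul, mul_sub, add_mul, mul_add, hpi, mul_one, one_mul]
    abel
  have h2 : ∀ S : VonNeumannAlgebra H, p ∈ S → 1 - 2 * p ∈ S := fun S hpS => by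
    rw [two_mul]; exact sub_mem (one_mem S) (add_mem hpS hpS)
  have hc := hT _ (mem_vnNormalizer_of_mem_commutant (h2 M hpM)
    ⟨by rw [hu, hu2], by rw [hu, hu2]⟩ (h2 _ hpN))
  have hp2 : p = (1 / 2 : ℂ) • (1 - (1 - 2 * p)) := by rw [two_mul]; module
  rw [hp2]
  exact ((Commute.one_right T).sub_right hc).smul_right _

theorem commute_of_selfAdjoint_normalizing (hN : ∀ x ∈ N, ∀ y ∈ N, Commute x y) (hNM : N ≤ M)
    (hT : ∀ u ∈ vnNormalizer M N, Commute T u) {z : H →L[ℂ] H} (hz : IsSelfAdjoint z)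
    (hzM : z ∈ M) (hzN : ∀ x ∈ N, z * x * z ∈ N) : Commute T z := by
  rw [← signSymm_mul_abs hz]
  have hbN : CFC.abs z ∈ N := abs_mem_of_star_mul_self_mem (by
    simpa [hz.star_eq] using hzN 1 (one_mem N))
  exact (hT _ (mem_vnNormalizer_of_symm (signSymm_mem hzM) (star_signSymm z)
    (signSymm_mul_self z) fun x hx => signSymm_conj_mem hN hz hzN hx)).mul_right
    (commute_of_mem_relativeCommutant hT (hNM hbN)
      (mem_commutant_of_commute fun x hx => hN x hx _ hbN))

/-- The off-diagonal corner of a normalizing operator with respect to a projection of `N` lies in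
the von Neumann algebra generated by the normalizing unitaries. -/
theorem commute_corner_of_normalizing (hN : ∀ x ∈ N, ∀ y ∈ N, Commute x y) (hNM : N ≤ M)
    (hT : ∀ u ∈ vnNormalizer M N, Commute T u) {a : H →L[ℂ] H} (haM : a ∈ M)
    (ha : ∀ x ∈ N, a * x * star a ∈ N) (ha' : ∀ x ∈ N, star a * x * a ∈ N)
    {r s : H →L[ℂ] H} (hr : r ∈ N) (hrs : star r = r) (hr2 : r * r = r)
    (hs : s ∈ N) (hss : star s = s) (hs2 : s * s = s) (hsr : s * r = 0) :
    Commute T (s * a * r) := by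
  have hcN : ∀ x ∈ N, Commute T x := fun x hx => commute_of_mem_relativeCommutant hT (hNM hx)
    (mem_commutant_of_commute fun y hy => hN y hy x hx)
  have hrs0 : r * s = 0 := by rw [(hN r hr s hs).eq, hsr]
  set y := s * a * r with hy
  have hys : star y = r * star a * s := by rw [hy, star_mul, star_mul, hrs, hss, mul_assoc]
  have hyM : y ∈ M := mul_mem (mul_mem (hNM hs) haM) (hNM hr)
  set z := y + star y with hz
  have hzsa : IsSelfAdjoint z := IsSelfAdjoint.add_star_self y
  have hzM : z ∈ M := add_mem hyM (star_mem hyM)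
  have hzN : ∀ x ∈ N, z * x * z ∈ N := by
    intro x hx
    have h1 : y * x * y = 0 := by
      calc y * x * y = s * a * (r * x) * s * a * r := by rw [hy]; simp only [mul_assoc]
        _ = s * a * x * (r * s) * a * r := by rw [(hN r hr x hx).eq]; simp only [mul_assoc]
        _ = 0 := by rw [hrs0]; simp
    have h2 : star y * x * star y = 0 := by
      calc star y * x * star y = r * star a * (s * x) * r * star a * s := by
            rw [hys]; simp only [mul_assoc]
        _ = r * star a * x * (s * r) * star a * s := by
            rw [(hN s hs x hx).eq]; simp only [mul_assoc]
        _ = 0 := by rw [hsr]; simp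
    have h3 : y * x * star y ∈ N := by
      have : y * x * star y = s * (a * (r * x * r) * star a) * s := by
        rw [hys, hy]; simp only [mul_assoc]
      rw [this]
      exact mul_mem (mul_mem hs (ha _ (mul_mem (mul_mem hr hx) hr))) hs
    have h4 : star y * x * y ∈ N := by
      have : star y * x * y = r * (star a * (s * x * s) * a) * r := by
        rw [hys, hy]; simp only [mul_assoc]
      rw [this]
      exact mul_mem (mul_mem hr (ha' _ (mul_mem (mul_mem hs hx) hs))) hr
    have : z * x * z = y * x * star y + star y * x * y := by
      rw [hz, add_mul, add_mul, mul_add, mul_add, h1, h2]; abel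
    rw [this]
    exact add_mem h3 h4
  have hTz := commute_of_selfAdjoint_normalizing hN hNM hT hzsa hzM hzN
  have hyz : y = s * z * r := by
    rw [hz, mul_add, add_mul, hys]
    have h1 : s * y * r = y := by
      calc s * y * r = (s * s) * a * (r * r) := by rw [hy]; simp only [mul_assoc]
        _ = y := by rw [hs2, hr2]
    have h2 : s * (r * star a * s) * r = (s * r) * star a * (s * r) := by simp only [mul_assoc]
    rw [h1, h2, hsr]; simp
  rw [hyz]
  exact ((hcN s hs).mul_right hTz).mul_right (hcN r hr)

/-- Every normalizing operator lies in the von Neumann algebra generated by the normalizing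
unitaries. -/
theorem commute_of_normalizing (hN : ∀ x ∈ N, ∀ y ∈ N, Commute x y) (hNM : N ≤ M)
    (hT : ∀ u ∈ vnNormalizer M N, Commute T u) {a : H →L[ℂ] H} (haM : a ∈ M)
    (ha : ∀ x ∈ N, a * x * star a ∈ N) (ha' : ∀ x ∈ N, star a * x * a ∈ N) : Commute T a := by
  have hcN : ∀ x ∈ N, Commute T x := fun x hx => commute_of_mem_relativeCommutant hT (hNM hx)
    (mem_commutant_of_commute fun y hy => hN y hy x hx)
  set D := T * a - a * T with hD
  have hcorner : ∀ r ∈ N, IsStarProjection r → Commute T ((1 - r) * a * r) := fun r hr hrp =>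
    commute_corner_of_normalizing hN hNM hT haM ha ha' hr hrp.isSelfAdjoint hrp.isIdempotentElem
      (sub_mem (one_mem N) hr) hrp.one_sub.isSelfAdjoint hrp.one_sub.isIdempotentElem (by
        rw [sub_mul, one_mul, hrp.isIdempotentElem.eq, sub_self])
  have hcomm_of_corner : ∀ w : H →L[ℂ] H,
      (∀ r ∈ N, IsStarProjection r → (1 - r) * w * r = 0) → w ∈ N.commutant := fun w hw =>
    mem_commutant_of_commute fun x hx => (commute_of_commute_projections_mem (T := w)
      (fun r hr hrp => by
        have h1 := hw r hr hrp
        have h2 := hw (1 - r) (sub_mem (one_mem N) hr) hrp.one_sub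
        rw [sub_sub_cancel] at h2
        rw [sub_mul, sub_mul, one_mul, sub_eq_zero] at h1
        rw [mul_sub, mul_one, sub_eq_zero] at h2
        exact h1.trans h2.symm) hx).symm
  have hDc : ∀ r ∈ N, IsStarProjection r → D * (r * star a * (1 - r) * a * r) = 0 := by
    intro r hr hrp
    set y := (1 - r) * a * r with hy
    set d := a * r * star a with hd
    have hdN : d ∈ N := ha r hr
    set c := r * star a * (1 - r) * a * r with hc
    have hcN' : c ∈ N := by
      have : c = r * (star a * (1 - r) * a) * r := by rw [hc]; simp only [mul_assoc]
      rw [this]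
      exact mul_mem (mul_mem hr (ha' _ (sub_mem (one_mem N) hr))) hr
    have hac : a * c = d * y := by rw [hc, hd, hy]; simp only [mul_assoc]
    have hTy : Commute T y := hcorner r hr hrp
    clear_value c d y
    rw [hD, sub_mul, mul_assoc T a c, mul_assoc a T c, (hcN c hcN').eq, ← mul_assoc a, hac,
      ((hcN d hdN).mul_right hTy).eq, sub_self]
  let K : Submodule ℂ H := ⨅ y : N.commutant, (D * (y : H →L[ℂ] H)).ker
  have hmemK : ∀ ξ, ξ ∈ K ↔ ∀ y ∈ N.commutant, D (y ξ) = 0 := fun ξ => by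
    simp [K, Submodule.mem_iInf]
  have hKc : IsClosed (K : Set H) := by
    rw [Submodule.coe_iInf]
    exact isClosed_iInter fun y => (D * (y : H →L[ℂ] H)).isClosed_ker
  have : CompleteSpace K := hKc.completeSpace_coe
  set h := K.starProjection with hh
  have hKinv : ∀ y ∈ N.commutant, ∀ ξ ∈ K, y ξ ∈ K := fun y hy ξ hξ => by
    rw [hmemK] at hξ ⊢
    exact fun y' hy' => hξ (y' * y) (mul_mem hy' hy)
  have hhN : h ∈ N := mem_of_commute_commutant fun y hy =>
    (commute_starProjection (hKinv y hy) (hKinv _ (star_mem hy))).symm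
  have hhs : star h = h := isSelfAdjoint_starProjection K
  have hDh : D * h = 0 := by
    ext ξ
    exact (hmemK _).1 (K.starProjection_apply_mem ξ) 1 (one_mem _)
  have hq : a * (1 - h) ∈ N.commutant := by
    refine hcomm_of_corner _ fun r hr hrp => ?_
    set c := r * star a * (1 - r) * a * r with hc
    have hcN' : c ∈ N := by
      have : c = r * (star a * (1 - r) * a) * r := by rw [hc]; simp only [mul_assoc]
      rw [this]
      exact mul_mem (mul_mem hr (ha' _ (sub_mem (one_mem N) hr))) hr
    have hhc : h * c = c := by
      ext ξ
      refine Submodule.starProjection_eq_self_iff.2 ((hmemK _).2 fun y hy => ?_)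
      have h1 := DFunLike.congr_fun (commute_of_mem_commutant hcN' hy).eq ξ
      have h2 := DFunLike.congr_fun (hDc r hr hrp) (y ξ)
      simp only [mul_apply_eq_comp] at h1
      exact (congrArg D h1.symm).trans h2
    have hrh : (1 - h) * r = r * (1 - h) := (hN _ (sub_mem (one_mem N) hhN) r hr).eq
    apply eq_zero_of_star_mul_self
    rw [mul_assoc, mul_assoc a, hrh]
    have hs1 : star (1 - r) = 1 - r := hrp.one_sub.isSelfAdjoint
    have hs2 : (1 - r) * (1 - r) = 1 - r := hrp.one_sub.isIdempotentElem
    have hs3 : star (1 - h) = 1 - h := by rw [star_sub, star_one, hhs]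
    calc star ((1 - r) * (a * (r * (1 - h)))) * ((1 - r) * (a * (r * (1 - h))))
        = (1 - h) * (r * star a * ((1 - r) * (1 - r)) * a * r) * (1 - h) := by
          simp only [star_mul, hs1, hs3, hrp.isSelfAdjoint.star_eq, mul_assoc]
      _ = (1 - h) * c * (1 - h) := by rw [hs2]
      _ = 0 := by rw [sub_mul, one_mul, hhc, sub_self, zero_mul]
  have hqM : a * (1 - h) ∈ M := mul_mem haM (sub_mem (one_mem M) (hNM hhN))
  have hTq : Commute T (1 - h) := hcN _ (sub_mem (one_mem N) hhN)
  have hDq : D * (1 - h) = 0 := by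
    rw [hD, sub_mul, mul_assoc, mul_assoc, hTq.eq, ← mul_assoc a,
      (commute_of_mem_relativeCommutant hT hqM hq).eq, sub_self]
  have hD0 : D = 0 := by
    rw [mul_sub, mul_one, hDh, sub_zero] at hDq
    exact hDq
  exact sub_eq_zero.1 hD0

end Normalizing

/-! ### The double commutant of a possibly degenerate `*`-algebra -/

section Amplification

/-- The operator `x ⊕ x` on `H ⊕ H`. -/
noncomputable def amp (x : H →L[ℂ] H) : WithLp 2 (H × H) →L[ℂ] WithLp 2 (H × H) :=
  (WithLp.prodContinuousLinearEquiv 2 ℂ H H).symm.toContinuousLinearMap ∘L (x.prodMap x) ∘L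
    (WithLp.prodContinuousLinearEquiv 2 ℂ H H).toContinuousLinearMap

theorem amp_apply (x : H →L[ℂ] H) (ζ : WithLp 2 (H × H)) :
    amp x ζ = WithLp.toLp 2 (x ζ.fst, x ζ.snd) := rfl

theorem star_amp (x : H →L[ℂ] H) : star (amp x) = amp (star x) := by
  rw [ContinuousLinearMap.star_eq_adjoint]
  refine ((ContinuousLinearMap.eq_adjoint_iff _ _).2 fun ζ ω => ?_).symm
  simp [WithLp.prod_inner_apply, amp_apply, ContinuousLinearMap.star_eq_adjoint,
    ContinuousLinearMap.adjoint_inner_left]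

/-- The double commutant of an amplified set contains the amplified double commutant. -/
theorem commute_amp_of_mem_bicommutant {S : Set (H →L[ℂ] H)}
    {Q : WithLp 2 (H × H) →L[ℂ] WithLp 2 (H × H)} (hQ : ∀ c ∈ S, Commute Q (amp c))
    {x : H →L[ℂ] H} (hx : x ∈ S.centralizer.centralizer) : Commute Q (amp x) := by
  let e := (WithLp.prodContinuousLinearEquiv 2 ℂ H H)
  let i₁ : H →L[ℂ] WithLp 2 (H × H) := e.symm.toContinuousLinearMap ∘L ContinuousLinearMap.inl ℂ H H
  let i₂ : H →L[ℂ] WithLp 2 (H × H) := e.symm.toContinuousLinearMap ∘L ContinuousLinearMap.inr ℂ H H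
  let p₁ : WithLp 2 (H × H) →L[ℂ] H := ContinuousLinearMap.fst ℂ H H ∘L e.toContinuousLinearMap
  let p₂ : WithLp 2 (H × H) →L[ℂ] H := ContinuousLinearMap.snd ℂ H H ∘L e.toContinuousLinearMap
  have hi₁ : ∀ (w : H →L[ℂ] H) ξ, i₁ (w ξ) = amp w (i₁ ξ) := fun w ξ => by
    rw [amp_apply]
    exact congrArg (WithLp.toLp 2) (Prod.ext rfl (map_zero w).symm)
  have hi₂ : ∀ (w : H →L[ℂ] H) ξ, i₂ (w ξ) = amp w (i₂ ξ) := fun w ξ => by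
    rw [amp_apply]
    exact congrArg (WithLp.toLp 2) (Prod.ext (map_zero w).symm rfl)
  have entry : ∀ (p : WithLp 2 (H × H) →L[ℂ] H) (i : H →L[ℂ] WithLp 2 (H × H)),
      (∀ (w : H →L[ℂ] H) ζ, p (amp w ζ) = w (p ζ)) →
      (∀ (w : H →L[ℂ] H) ξ, i (w ξ) = amp w (i ξ)) →
      ∀ ξ, p (Q (amp x (i ξ))) = p (amp x (Q (i ξ))) := by
    intro p i hp hi ξ
    have hmem : p ∘L Q ∘L i ∈ S.centralizer := fun c hc => by
      ext ξ
      have h := DFunLike.congr_fun (hQ c hc).eq (i ξ)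
      simp only [mul_apply_eq_comp] at h
      simp only [mul_apply_eq_comp, ContinuousLinearMap.comp_apply]
      rw [hi, h, hp]
    have h := DFunLike.congr_fun (hx _ hmem) ξ
    simp only [mul_apply_eq_comp, ContinuousLinearMap.comp_apply] at h
    rw [hp, ← hi, h]
  have hsum : ∀ ζ : WithLp 2 (H × H), ζ = i₁ ζ.fst + i₂ ζ.snd := fun ζ =>
    (congrArg (WithLp.toLp 2) (Prod.ext (add_zero ζ.fst) (zero_add ζ.snd))).symm
  have hp₁ : ∀ (w : H →L[ℂ] H) ζ, p₁ (amp w ζ) = w (p₁ ζ) := fun _ _ => rfl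
  have hp₂ : ∀ (w : H →L[ℂ] H) ζ, p₂ (amp w ζ) = w (p₂ ζ) := fun _ _ => rfl
  refine ContinuousLinearMap.ext fun ζ => ?_
  simp only [mul_apply_eq_comp]
  rw [hsum ζ]
  simp only [map_add]
  refine congrArg₂ (· + ·) ?_ ?_
  · exact congrArg (WithLp.toLp 2)
      (Prod.ext (entry p₁ i₁ hp₁ hi₁ ζ.fst) (entry p₂ i₁ hp₂ hi₁ ζ.fst))
  · exact congrArg (WithLp.toLp 2)
      (Prod.ext (entry p₁ i₂ hp₁ hi₂ ζ.snd) (entry p₂ i₂ hp₂ hi₂ ζ.snd))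

end Amplification

section Degenerate

variable (S : NonUnitalStarSubalgebra ℂ (H →L[ℂ] H))

/-- The vectors annihilated by `S`. -/
def annihilated : Submodule ℂ H := ⨅ c : S, (c : H →L[ℂ] H).ker

theorem mem_annihilated {ξ : H} : ξ ∈ annihilated S ↔ ∀ c ∈ S, c ξ = 0 := by
  simp [annihilated, Submodule.mem_iInf]

instance : CompleteSpace (annihilated S) := by
  have h : IsClosed (annihilated S : Set H) := by
    rw [annihilated, Submodule.coe_iInf]
    exact isClosed_iInter fun c => (c : H →L[ℂ] H).isClosed_ker
  exact h.completeSpace_coe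

/-- The projection onto the vectors annihilated by `S`. -/
noncomputable def annProj : H →L[ℂ] H := (annihilated S).starProjection

theorem star_annProj : star (annProj S) = annProj S :=
  isSelfAdjoint_starProjection (annihilated S)

theorem mul_annProj {c : H →L[ℂ] H} (hc : c ∈ S) : c * annProj S = 0 := by
  ext ξ
  exact (mem_annihilated S).1 ((annihilated S).starProjection_apply_mem ξ) c hc

theorem annProj_mul {c : H →L[ℂ] H} (hc : c ∈ S) : annProj S * c = 0 := by
  have := congrArg star (mul_annProj S (star_mem hc))
  simpa [star_annProj] using this

theorem star_mem_centralizer {y : H →L[ℂ] H} (hy : y ∈ (S : Set (H →L[ℂ] H)).centralizer) :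
    star y ∈ (S : Set (H →L[ℂ] H)).centralizer :=
  star_mem_commutant (fun _ hc => star_mem (S := NonUnitalStarSubalgebra ℂ (H →L[ℂ] H)) hc) hy

theorem mem_bicommutant_of_mem {c : H →L[ℂ] H} (hc : c ∈ S) : c ∈ bicommutant S :=
  Set.subset_centralizer_centralizer hc

theorem mem_commutant_bicommutant_iff {y : H →L[ℂ] H} :
    y ∈ (bicommutant S).commutant ↔ y ∈ (S : Set (H →L[ℂ] H)).centralizer := by
  rw [← SetLike.mem_coe, VonNeumannAlgebra.coe_commutant]
  change y ∈ (S : Set (H →L[ℂ] H)).centralizer.centralizer.centralizer ↔ _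
  rw [Set.centralizer_centralizer_centralizer]

theorem annProj_mem_bicommutant : annProj S ∈ bicommutant S := by
  have inv : ∀ y ∈ (S : Set (H →L[ℂ] H)).centralizer, ∀ ξ ∈ annihilated S,
      y ξ ∈ annihilated S := fun y hy ξ hξ => by
    rw [mem_annihilated] at hξ ⊢
    intro c hc
    have := DFunLike.congr_fun (hy c hc) ξ
    simp only [mul_apply_eq_comp] at this
    rw [this, hξ c hc, map_zero]
  intro y hy
  exact (commute_starProjection (inv y hy) (inv _ (star_mem_centralizer S hy))).eq.symm

/-- Two-vector form of the double commutant theorem. -/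
theorem toLp_mem_closure_of_mem_bicommutant {x : H →L[ℂ] H} (hx : x ∈ bicommutant S) (ξ η : H) :
    WithLp.toLp 2 (x ((1 - annProj S) ξ), x ((1 - annProj S) η)) ∈
      closure {ζ : WithLp 2 (H × H) | ∃ c ∈ S, ζ = WithLp.toLp 2 (c ξ, c η)} := by
  let ζ₀ : WithLp 2 (H × H) := WithLp.toLp 2 (ξ, η)
  let K₀ : Submodule ℂ (WithLp 2 (H × H)) :=
    { carrier := {ζ | ∃ c ∈ S, ζ = WithLp.toLp 2 (c ξ, c η)}
      add_mem' := by
        rintro _ _ ⟨c, hc, rfl⟩ ⟨d, hd, rfl⟩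
        exact ⟨c + d, add_mem hc hd, rfl⟩
      zero_mem' := ⟨0, zero_mem S, rfl⟩
      smul_mem' := by
        rintro r _ ⟨c, hc, rfl⟩
        exact ⟨r • c, SMulMemClass.smul_mem r hc, rfl⟩ }
  set K := K₀.topologicalClosure with hK
  have : CompleteSpace K := K₀.isClosed_topologicalClosure.completeSpace_coe
  have inv : ∀ c ∈ S, ∀ ζ ∈ K, amp c ζ ∈ K := fun c hc ζ hζ => by
    refine map_mem_closure (amp c).continuous hζ ?_
    rintro _ ⟨d, hd, rfl⟩
    exact ⟨c * d, mul_mem hc hd, rfl⟩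
  have hP : ∀ c ∈ S, Commute K.starProjection (amp c) := fun c hc =>
    commute_starProjection (inv c hc) (by rw [star_amp]; exact inv _ (star_mem hc))
  have hPx := commute_amp_of_mem_bicommutant (S := (S : Set (H →L[ℂ] H))) hP hx
  have hPe := commute_amp_of_mem_bicommutant (S := (S : Set (H →L[ℂ] H))) hP
    (sub_mem (one_mem (bicommutant S)) (annProj_mem_bicommutant S))
  set δ := ζ₀ - K.starProjection ζ₀ with hδ
  have hann : ∀ c ∈ S, amp c δ = 0 := fun c hc => by
    have h := DFunLike.congr_fun (hP c hc).eq ζ₀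
    simp only [mul_apply_eq_comp] at h
    have hmem : amp c ζ₀ ∈ K := K₀.le_topologicalClosure ⟨c, hc, rfl⟩
    rw [hδ, map_sub, ← h, Submodule.starProjection_eq_self_iff.2 hmem, sub_self]
  have h1 : annProj S δ.fst = δ.fst := Submodule.starProjection_eq_self_iff.2
    ((mem_annihilated S).2 fun c hc => congrArg WithLp.fst (hann c hc))
  have h2 : annProj S δ.snd = δ.snd := Submodule.starProjection_eq_self_iff.2
    ((mem_annihilated S).2 fun c hc => congrArg WithLp.snd (hann c hc))
  have h3 : amp (1 - annProj S) δ = 0 := by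
    rw [amp_apply]
    refine congrArg (WithLp.toLp 2) (Prod.ext ?_ ?_)
    · exact sub_eq_zero.2 h1.symm
    · exact sub_eq_zero.2 h2.symm
  have h4 : amp (1 - annProj S) ζ₀ ∈ K := by
    rw [hδ, map_sub, sub_eq_zero] at h3
    have h := DFunLike.congr_fun hPe.eq ζ₀
    simp only [mul_apply_eq_comp] at h
    rw [h3, ← h]
    exact K.starProjection_apply_mem _
  have h5 : amp x (amp (1 - annProj S) ζ₀) ∈ K := by
    have h := DFunLike.congr_fun hPx.eq (amp (1 - annProj S) ζ₀)
    simp only [mul_apply_eq_comp] at h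
    rw [Submodule.starProjection_eq_self_iff.2 h4] at h
    rw [← h]
    exact K.starProjection_apply_mem _
  exact h5

variable {S}

theorem commute_annProj_of_normalizing {n : H →L[ℂ] H} (hn : ∀ c ∈ S, n * c * star n ∈ S)
    (hn' : ∀ c ∈ S, star n * c * n ∈ S) : Commute (annProj S) n := by
  have inv : ∀ m : H →L[ℂ] H, (∀ c ∈ S, star m * c * m ∈ S) → ∀ ξ ∈ annihilated S,
      m ξ ∈ annihilated S := fun m hm ξ hξ => by
    rw [mem_annihilated] at hξ ⊢
    intro c hc
    have h := hξ _ (hm _ (mul_mem (star_mem hc) hc))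
    have h2 : star (c * m) * (c * m) = star m * (star c * c) * m := by
      rw [star_mul]; simp only [mul_assoc]
    rw [← h2, ContinuousLinearMap.star_eq_adjoint] at h
    have h3 := ContinuousLinearMap.apply_norm_sq_eq_inner_adjoint_left (c * m) ξ
    have h4 : (ContinuousLinearMap.adjoint (c * m) ∘L (c * m)) ξ = 0 := h
    rw [h4, inner_zero_left, map_zero] at h3
    exact norm_eq_zero.1 (pow_eq_zero_iff two_ne_zero |>.1 h3)
  exact commute_starProjection (inv n hn') (inv (star n) (by simpa using hn))

theorem mul_mul_star_mem_bicommutant {n : H →L[ℂ] H} (hn : ∀ c ∈ S, n * c * star n ∈ S)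
    {x : H →L[ℂ] H} (hx : x ∈ bicommutant S) :
    n * (x * (1 - annProj S)) * star n ∈ bicommutant S := by
  intro y hy
  ext w
  have hcl := toLp_mem_closure_of_mem_bicommutant S hx (star n w) (star n (y w))
  let G : WithLp 2 (H × H) → H := fun ζ => y (n ζ.fst) - n ζ.snd
  have hG : Continuous G :=
    (y.continuous.comp (n.continuous.comp (WithLp.continuous_fst 2 H H))).sub
      (n.continuous.comp (WithLp.continuous_snd 2 H H))
  have hclosed : IsClosed {ζ | G ζ = 0} := isClosed_eq hG continuous_const
  have hsub : {ζ : WithLp 2 (H × H) | ∃ c ∈ S, ζ = WithLp.toLp 2 (c (star n w), c (star n (y w)))} ⊆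
      {ζ | G ζ = 0} := by
    rintro _ ⟨c, hc, rfl⟩
    have h := DFunLike.congr_fun (hy _ (hn c hc)) w
    simp only [mul_apply_eq_comp] at h
    exact sub_eq_zero.2 h.symm
  exact sub_eq_zero.1 (hclosed.closure_subset_iff.2 hsub hcl)

/-- An operator normalizing `S` lies in the von Neumann algebra generated by the unitaries
normalizing `S''`. -/
theorem commute_of_normalizing_starSubalgebra {M : VonNeumannAlgebra H}
    (hS : ∀ x ∈ S, ∀ y ∈ S, x * y = y * x) (hSM : bicommutant S ≤ M) {T n : H →L[ℂ] H}
    (hT : ∀ u ∈ vnNormalizer M (bicommutant S), Commute T u) (hnM : n ∈ M)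
    (hn : ∀ c ∈ S, n * c * star n ∈ S) (hn' : ∀ c ∈ S, star n * c * n ∈ S) : Commute T n := by
  set f := annProj S with hf
  have hfN : f ∈ bicommutant S := annProj_mem_bicommutant S
  have hN : ∀ x ∈ bicommutant S, ∀ y ∈ bicommutant S, Commute x y :=
    Set.centralizer_centralizer_comm_of_comm hS
  have hfn : Commute f n := commute_annProj_of_normalizing hn hn'
  have hfn' : Commute f (star n) := commute_annProj_of_normalizing (by simpa using hn')
    (by simpa using hn)
  have hes : star (1 - f) = 1 - f := by rw [star_sub, star_one, star_annProj]
  have hen : Commute (1 - f) n := (Commute.one_left n).sub_left hfn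
  have hen' : Commute (1 - f) (star n) := (Commute.one_left _).sub_left hfn'
  have h1 : Commute T (n * f) := by
    refine commute_of_mem_relativeCommutant hT (mul_mem hnM (hSM hfN))
      ((mem_commutant_bicommutant_iff S).2 fun c hc => ?_)
    rw [mul_assoc, annProj_mul S hc, mul_zero, ← hfn.eq, ← mul_assoc, mul_annProj S hc, zero_mul]
  have h2 : Commute T (n * (1 - f)) := by
    refine commute_of_normalizing hN hSM hT (mul_mem hnM (sub_mem (one_mem M) (hSM hfN)))
      (fun x hx => ?_) (fun x hx => ?_)
    · have : n * (1 - f) * x * star (n * (1 - f)) = n * ((1 - f) * x * (1 - f)) * star n := by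
        rw [star_mul, hes]; simp only [mul_assoc]
      rw [this]
      exact mul_mul_star_mem_bicommutant hn
        (mul_mem (sub_mem (one_mem (bicommutant S)) hfN) hx)
    · have : star (n * (1 - f)) * x * (n * (1 - f)) =
          star n * ((1 - f) * x * (1 - f)) * star (star n) := by
        rw [star_mul, hes, ← hen.eq, hen'.eq, star_star]; simp only [mul_assoc]
      rw [this]
      exact mul_mul_star_mem_bicommutant (by simpa using hn')
        (mul_mem (sub_mem (one_mem (bicommutant S)) hfN) hx)
  have h3 : n = n * f + n * (1 - f) := by rw [mul_sub, mul_one]; abel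
  rw [h3]
  exact h1.add_right h2

end Degenerate

/-- A regular abelian `*`-subalgebra of a C*-algebra generates a regular von Neumann subalgebra. -/
theorem isVNRegular_bicommutant {A : Type*} [NonUnitalCStarAlgebra A]
    (C : NonUnitalStarSubalgebra ℂ A) (hC : ∀ x ∈ C, ∀ y ∈ C, x * y = y * x)
    (hreg : IsCStarRegular C) (π : A →⋆ₙₐ[ℂ] (H →L[ℂ] H)) :
    IsVNRegular (bicommutant (NonUnitalStarAlgHom.range π)) (bicommutant (C.map π)) := by
  set R := NonUnitalStarAlgHom.range π with hR
  set S := C.map π with hS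
  have hSR : (S : Set (H →L[ℂ] H)) ⊆ R := by
    rintro _ ⟨c, _, rfl⟩
    exact ⟨c, rfl⟩
  have hle : bicommutant S ≤ bicommutant R :=
    Set.centralizer_subset (Set.centralizer_subset hSR)
  have hScomm : ∀ x ∈ S, ∀ y ∈ S, x * y = y * x := by
    rintro _ ⟨c, hc, rfl⟩ _ ⟨d, hd, rfl⟩
    exact (map_mul π c d).symm.trans ((congrArg π (hC c hc d hd)).trans (map_mul π d c))
  refine ⟨hle, subset_antisymm ?_ ?_⟩
  · rw [← VonNeumannAlgebra.centralizer_centralizer (bicommutant R)]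
    exact Set.centralizer_subset (Set.centralizer_subset fun u hu => hu.1)
  · refine Set.centralizer_subset fun T hT => ?_
    have hTn : ∀ n ∈ cstarNormalizer C, Commute T (π n) := fun n hn => by
      refine commute_of_normalizing_starSubalgebra hScomm hle (fun u hu => (hT u hu).symm)
        (mem_bicommutant_of_mem R ⟨n, rfl⟩) ?_ ?_
      · rintro _ ⟨c, hc, rfl⟩
        refine ⟨n * c * star n, (hn c hc).1, ?_⟩
        exact (map_mul π _ _).trans (by rw [map_mul, map_star]; rfl)
      · rintro _ ⟨c, hc, rfl⟩
        refine ⟨star n * c * n, (hn c hc).2, ?_⟩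
        exact (map_mul π _ _).trans (by rw [map_mul, map_star]; rfl)
    have hstar : ∀ n ∈ cstarNormalizer C, star n ∈ cstarNormalizer C := fun n hn c hc => by
      rw [star_star]; exact ⟨(hn c hc).2, (hn c hc).1⟩
    have hadj : ∀ a ∈ NonUnitalStarAlgebra.adjoin ℂ (cstarNormalizer C),
        Commute T (π a) ∧ Commute T (π (star a)) := by
      intro a ha
      induction ha using NonUnitalStarAlgebra.adjoin_induction with
      | mem n hn => exact ⟨hTn n hn, hTn _ (hstar n hn)⟩
      | add a b _ _ ha hb =>
        rw [star_add, map_add, map_add]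
        exact ⟨ha.1.add_right hb.1, ha.2.add_right hb.2⟩
      | zero =>
        rw [star_zero, map_zero]
        exact ⟨Commute.zero_right T, Commute.zero_right T⟩
      | mul a b _ _ ha hb =>
        rw [star_mul, map_mul, map_mul]
        exact ⟨ha.1.mul_right hb.1, hb.2.mul_right ha.2⟩
      | smul r a _ ha =>
        rw [star_smul, map_smul, map_smul]
        exact ⟨ha.1.smul_right r, ha.2.smul_right (star r)⟩
      | star a _ ha =>
        rw [star_star]
        exact ⟨ha.2, ha.1⟩
    have hcont : Continuous π := AddMonoidHomClass.continuous_of_bound π 1 fun a => by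
      rw [one_mul]; exact NonUnitalStarAlgHom.norm_apply_le π a
    have hclosed : IsClosed {a : A | T * π a = π a * T} :=
      isClosed_eq (continuous_const.mul hcont) (hcont.mul continuous_const)
    rintro _ ⟨a, rfl⟩
    have ha : a ∈ (NonUnitalStarAlgebra.adjoin ℂ (cstarNormalizer C)).topologicalClosure := by
      rw [hreg]; trivial
    exact (hclosed.closure_subset_iff.2 (fun b hb => (hadj b hb).1.eq) ha).symm


/-! ### Orthogonal projections in finite von Neumann algebras -/

section Orthogonal

variable {p : ℕ → H →L[ℂ] H}

theorem mul_sum_orthogonal {ι : Type*} {p : ι → H →L[ℂ] H} (hp : ∀ k, IsStarProjection (p k))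
    (ho : ∀ j k, j ≠ k → p j * p k = 0) {F : Finset ι} {k : ι} (hk : k ∈ F) :
    p k * ∑ j ∈ F, p j = p k := by
  rw [Finset.mul_sum, Finset.sum_eq_single k (fun j _ hj => ho k j hj.symm)
    (fun h => absurd hk h), (hp k).isIdempotentElem.eq]

theorem isStarProjection_sum_orthogonal {ι : Type*} {p : ι → H →L[ℂ] H}
    (hp : ∀ k, IsStarProjection (p k)) (ho : ∀ j k, j ≠ k → p j * p k = 0) (F : Finset ι) :
    IsStarProjection (∑ k ∈ F, p k) := by
  refine ⟨?_, ?_⟩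
  · rw [IsIdempotentElem, Finset.sum_mul]
    exact Finset.sum_congr rfl fun k hk => mul_sum_orthogonal hp ho hk
  · rw [isSelfAdjoint_iff, star_sum]
    exact Finset.sum_congr rfl fun k _ => (hp k).isSelfAdjoint.star_eq

theorem norm_sq_projection_apply {e : H →L[ℂ] H} (he : IsStarProjection e) (ξ : H) :
    ‖e ξ‖ ^ 2 = RCLike.re (inner ℂ (e ξ) ξ) := by
  have h := ContinuousLinearMap.apply_norm_sq_eq_inner_adjoint_left e ξ
  have h1 : ContinuousLinearMap.adjoint e ∘L e = e := by
    rw [← ContinuousLinearMap.star_eq_adjoint, he.isSelfAdjoint.star_eq]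
    exact he.isIdempotentElem
  rwa [h1] at h

theorem norm_projection_apply_le {e : H →L[ℂ] H} (he : IsStarProjection e) (ξ : H) :
    ‖e ξ‖ ≤ ‖ξ‖ := by
  have h1 := norm_sq_projection_apply he ξ
  have h2 : RCLike.re (inner ℂ (e ξ) ξ) ≤ ‖e ξ‖ * ‖ξ‖ := re_inner_le_norm _ _
  by_contra! hlt
  nlinarith [norm_nonneg (e ξ), norm_nonneg ξ]

theorem norm_sq_sum_orthogonal_apply {ι : Type*} {p : ι → H →L[ℂ] H}
    (hp : ∀ k, IsStarProjection (p k)) (ho : ∀ j k, j ≠ k → p j * p k = 0) (F : Finset ι) (ξ : H) :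
    ‖(∑ k ∈ F, p k) ξ‖ ^ 2 = ∑ k ∈ F, ‖p k ξ‖ ^ 2 := by
  rw [norm_sq_projection_apply (isStarProjection_sum_orthogonal hp ho F),
    sum_apply, sum_inner, map_sum]
  exact Finset.sum_congr rfl fun k _ => (norm_sq_projection_apply (hp k) ξ).symm

theorem summable_norm_sq_orthogonal_apply (hp : ∀ k, IsStarProjection (p k))
    (ho : ∀ j k, j ≠ k → p j * p k = 0) (ξ : H) : Summable fun k => ‖p k ξ‖ ^ 2 := by
  refine summable_of_sum_le (c := ‖ξ‖ ^ 2) (fun k => by positivity) fun F => ?_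
  rw [← norm_sq_sum_orthogonal_apply hp ho]
  exact pow_le_pow_left₀ (norm_nonneg _)
    (norm_projection_apply_le (isStarProjection_sum_orthogonal hp ho F) ξ) 2

theorem norm_apply_of_star_mul_self_eq_one {u : H →L[ℂ] H} (hu : star u * u = 1) (ξ : H) :
    ‖u ξ‖ = ‖ξ‖ :=
  (ContinuousLinearMap.norm_map_iff_adjoint_comp_self u).2 hu ξ

/-- The product `t 0 * t 1 * ⋯ * t (n - 1)`. -/
def prodSeq (t : ℕ → H →L[ℂ] H) : ℕ → H →L[ℂ] H
  | 0 => 1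
  | n + 1 => prodSeq t n * t n

open Filter Topology in
/-- In a finite von Neumann algebra, there is no infinite sequence of nonzero orthogonal projections
in which consecutive members are exchanged by symmetries of the algebra. -/
theorem eq_zero_of_exchanged_sequence {M : VonNeumannAlgebra H} (hM : IsFiniteVN M)
    (hp : ∀ k, IsStarProjection (p k)) (ho : ∀ j k, j ≠ k → p j * p k = 0)
    {t : ℕ → H →L[ℂ] H} (htM : ∀ k, t k ∈ M) (hts : ∀ k, star (t k) * t k = 1)
    (htp : ∀ k, t k * p (k + 1) = p k * t k)
    (ht1 : ∀ k, t k * (1 - p k - p (k + 1)) = 1 - p k - p (k + 1)) : p 0 = 0 := by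
  set v := prodSeq t with hv
  have hv0 : v 0 = 1 := rfl
  have hvs : ∀ n, v (n + 1) = v n * t n := fun _ => rfl
  have hvM : ∀ n, v n ∈ M := fun n => by
    induction n with
    | zero => rw [hv0]; exact one_mem M
    | succ n ih => rw [hvs]; exact mul_mem ih (htM n)
  have hvn : ∀ n ξ, ‖v n ξ‖ = ‖ξ‖ := fun n => by
    induction n with
    | zero => intro ξ; rw [hv0]; rfl
    | succ n ih =>
      intro ξ
      rw [hvs, mul_apply_eq_comp, ih, norm_apply_of_star_mul_self_eq_one (hts n)]
  have hpv : ∀ n, p 0 * v n = v n * p n := fun n => by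
    induction n with
    | zero => rw [hv0, one_mul, mul_one]
    | succ n ih => rw [hvs, mul_assoc, htp, ← mul_assoc, ih, mul_assoc]
  have hfix : ∀ n m ξ, n ≤ m → (∀ k ∈ Finset.Ico n (m + 1), p k ξ = 0) → v m ξ = v n ξ := by
    intro n m ξ hnm
    induction m, hnm using Nat.le_induction with
    | base => intro _; rfl
    | succ m hnm ih =>
      intro h
      have h1 : p m ξ = 0 := h m (by simp; omega)
      have h2 : p (m + 1) ξ = 0 := h (m + 1) (by simp; omega)
      have h3 := DFunLike.congr_fun (ht1 m) ξ
      simp only [mul_apply_eq_comp, sub_apply, h1, h2, sub_zero,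
        one_apply_eq_self] at h3
      rw [hvs, mul_apply_eq_comp, h3]
      exact ih fun k hk => h k (by simp at hk ⊢; omega)
  have hsum := summable_norm_sq_orthogonal_apply hp ho
  have hcauchy : ∀ ξ, CauchySeq fun n => v n ξ := fun ξ => by
    set b : ℕ → ℝ := fun n => 2 * √(∑' k, ‖p (k + n) ξ‖ ^ 2) with hb
    refine cauchySeq_of_le_tendsto_0' b (fun n m hnm => ?_) ?_
    · set R := ∑ k ∈ Finset.Ico n (m + 1), p k with hR
      have h0 : v m (ξ - R ξ) = v n (ξ - R ξ) := hfix n m _ hnm fun k hk => by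
        have := DFunLike.congr_fun (mul_sum_orthogonal hp ho hk) ξ
        rw [map_sub, sub_eq_zero]
        exact this.symm
      have h1 : v n ξ - v m ξ = v n (R ξ) - v m (R ξ) := by
        rw [map_sub, map_sub] at h0
        exact sub_eq_sub_iff_sub_eq_sub.2 h0.symm
      have h2 : ‖R ξ‖ ≤ √(∑' k, ‖p (k + n) ξ‖ ^ 2) := by
        apply Real.le_sqrt_of_sq_le
        rw [norm_sq_sum_orthogonal_apply hp ho, Finset.sum_Ico_eq_sum_range]
        simp only [add_comm n]
        exact ((summable_nat_add_iff n).2 (hsum ξ)).sum_le_tsum _ fun _ _ => by positivity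
      rw [dist_eq_norm, h1, hb]
      refine (norm_sub_le _ _).trans ?_
      rw [hvn, hvn]
      linarith
    · have h := (tendsto_sum_nat_add fun k => ‖p k ξ‖ ^ 2).sqrt.const_mul 2
      simpa using h
  choose f hf using fun ξ => cauchySeq_tendsto_of_complete (hcauchy ξ)
  let w : H →L[ℂ] H := continuousLinearMapOfTendsto v (tendsto_pi_nhds.2 hf)
  have hw : ∀ ξ, Tendsto (fun n => v n ξ) atTop (𝓝 (w ξ)) := hf
  have hwM : w ∈ M := mem_of_commute_commutant fun y hy => by
    ext ξ
    refine tendsto_nhds_unique ((y.continuous.tendsto _).comp (hw ξ)) ?_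
    refine (hw (y ξ)).congr fun n => ?_
    exact DFunLike.congr_fun (commute_of_mem_commutant (hvM n) hy).eq ξ
  have hww : star w * w = 1 := by
    refine (ContinuousLinearMap.norm_map_iff_adjoint_comp_self w).1 fun ξ => ?_
    refine tendsto_nhds_unique (hw ξ).norm ?_
    simp only [hvn]
    exact tendsto_const_nhds
  have hpw : p 0 * w = 0 := by
    ext ξ
    refine tendsto_nhds_unique (((p 0).continuous.tendsto _).comp (hw ξ)) ?_
    have h1 : ∀ n, (p 0) (v n ξ) = v n (p n ξ) := fun n => DFunLike.congr_fun (hpv n) ξ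
    refine tendsto_zero_iff_norm_tendsto_zero.2 ?_
    have h2 := (hsum ξ).tendsto_atTop_zero.sqrt
    simpa [Function.comp_def, h1, hvn] using h2
  have := hM w hwM hww
  rw [← mul_one (p 0), ← this, ← mul_assoc, hpw, zero_mul]

/-- The symmetry exchanging two orthogonal projections that are conjugate by a unitary. -/
theorem exists_exchange {M : VonNeumannAlgebra H} {w e f : H →L[ℂ] H} (hw : w ∈ M)
    (hww : star w * w = 1) (hww' : w * star w = 1) (heM : e ∈ M) (he : IsStarProjection e)
    (hfM : f ∈ M) (hf : IsStarProjection f) (hef : e * f = 0) (hfe : f * e = 0)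
    (hwe : w * e = f * w) :
    ∃ t ∈ M, star t * t = 1 ∧ t * f = e * t ∧ t * (1 - e - f) = 1 - e - f := by
  have hes := he.isSelfAdjoint.star_eq
  have hfs := hf.isSelfAdjoint.star_eq
  have hee := he.isIdempotentElem.eq
  have hff := hf.isIdempotentElem.eq
  set a := w * e with ha
  set b := e * star w with hb
  have hab : star a = b := by rw [ha, hb, star_mul, hes]
  have hba : star b = a := by rw [← hab, star_star]
  have hae : a * e = a := by rw [ha, mul_assoc, hee]
  have hfa : f * a = a := by rw [hwe, ← mul_assoc, hff]
  have haf : a * f = 0 := by rw [ha, mul_assoc, hef, mul_zero]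
  have hea : e * a = 0 := by rw [hwe, ← mul_assoc, hef, zero_mul]
  have heb : e * b = b := by rw [hb, ← mul_assoc, hee]
  have hbf : b * f = b := by rw [← hab, ← hfs, ← star_mul, hfa]
  have hfb : f * b = 0 := by rw [hb, ← mul_assoc, hfe, zero_mul]
  have hbe : b * e = 0 := by rw [← hab, ← hes, ← star_mul, hea, star_zero]
  have hba1 : b * a = e := by rw [hb, ha, mul_assoc, ← mul_assoc _ w, hww, one_mul, hee]
  have hab1 : a * b = f := by
    rw [hb, ← mul_assoc, hae, hwe, mul_assoc, hww', mul_one]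
  have haa : a * a = 0 := by rw [← hae, mul_assoc, ← mul_assoc e, hea, zero_mul, mul_zero]
  have hbb : b * b = 0 := by rw [← hbf, mul_assoc, ← mul_assoc f, hfb, zero_mul, mul_zero]
  clear_value a b
  have haM : a ∈ M := by rw [ha]; exact mul_mem hw heM
  refine ⟨a + b + (1 - e - f), add_mem (add_mem haM (hab ▸ star_mem haM))
    (sub_mem (sub_mem (one_mem M) heM) hfM), ?_, ?_, ?_⟩
  · have : star (a + b + (1 - e - f)) = a + b + (1 - e - f) := by
      simp only [star_add, star_sub, star_one, hab, hba, hes, hfs]; abel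
    rw [this]
    simp only [add_mul, mul_add, sub_mul, mul_sub, mul_one, one_mul, haa, hbb, hab1, hba1, hae,
      haf, hea, hfa, heb, hfb, hbe, hbf, hee, hff, hef, hfe]
    abel
  · simp only [add_mul, mul_add, sub_mul, mul_sub, mul_one, one_mul, haf, hbf, hea, heb, hee, hff,
      hef]
    abel
  · simp only [add_mul, sub_mul, mul_sub, mul_one, one_mul, hae, haf, hbe, hbf, hee, hff,
      hef, hfe]
    abel

end Orthogonal

/-! ### Minimal projections of regular abelian subalgebras -/

section Minimal

variable {M N : VonNeumannAlgebra H}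

theorem conj_mem_of_mem_vnNormalizer {u : H →L[ℂ] H} (hu : u ∈ vnNormalizer M N) {x : H →L[ℂ] H}
    (hx : x ∈ N) : u * x * star u ∈ N := by
  have : u * x * star u ∈ (fun x => u * x * star u) '' (N : Set (H →L[ℂ] H)) := ⟨x, hx, rfl⟩
  rwa [hu.2.2] at this

theorem star_conj_mem_of_mem_vnNormalizer {u : H →L[ℂ] H} (hu : u ∈ vnNormalizer M N)
    {x : H →L[ℂ] H} (hx : x ∈ N) : star u * x * u ∈ N := by
  have hx' : x ∈ (fun x => u * x * star u) '' (N : Set (H →L[ℂ] H)) := by rw [hu.2.2]; exact hx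
  obtain ⟨y, hy, rfl⟩ := hx'
  have : star u * (u * y * star u) * u = (star u * u) * y * (star u * u) := by
    simp only [mul_assoc]
  simp only [this, hu.2.1.1, one_mul, mul_one]
  exact hy

theorem mem_vnNormalizer_iff {u : H →L[ℂ] H} : u ∈ vnNormalizer M N ↔
    u ∈ M ∧ u ∈ unitary (H →L[ℂ] H) ∧ (∀ x ∈ N, u * x * star u ∈ N) ∧
      ∀ x ∈ N, star u * x * u ∈ N := by
  refine ⟨fun hu => ⟨hu.1, hu.2.1, fun x hx => conj_mem_of_mem_vnNormalizer hu hx,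
    fun x hx => star_conj_mem_of_mem_vnNormalizer hu hx⟩, fun ⟨h1, h2, h3, h4⟩ => ⟨h1, h2, ?_⟩⟩
  ext x
  constructor
  · rintro ⟨y, hy, rfl⟩
    exact h3 y hy
  · refine fun hx => ⟨star u * x * u, h4 x hx, ?_⟩
    have : u * (star u * x * u) * star u = (u * star u) * x * (u * star u) := by
      simp only [mul_assoc]
    simp only [this, h2.2, one_mul, mul_one]

theorem one_mem_vnNormalizer : (1 : H →L[ℂ] H) ∈ vnNormalizer M N :=
  mem_vnNormalizer_iff.2 ⟨one_mem M, one_mem _, by simp, by simp⟩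

theorem star_mem_vnNormalizer {u : H →L[ℂ] H} (hu : u ∈ vnNormalizer M N) :
    star u ∈ vnNormalizer M N := by
  obtain ⟨h1, h2, h3, h4⟩ := mem_vnNormalizer_iff.1 hu
  exact mem_vnNormalizer_iff.2 ⟨star_mem h1, Unitary.star_mem h2, by simpa using h4,
    by simpa using h3⟩

theorem mul_mem_vnNormalizer {u w : H →L[ℂ] H} (hu : u ∈ vnNormalizer M N)
    (hw : w ∈ vnNormalizer M N) : u * w ∈ vnNormalizer M N := by
  refine mem_vnNormalizer_iff.2 ⟨mul_mem hu.1 hw.1, mul_mem hu.2.1 hw.2.1, fun x hx => ?_,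
    fun x hx => ?_⟩
  · have := conj_mem_of_mem_vnNormalizer hu (conj_mem_of_mem_vnNormalizer hw hx)
    simpa only [star_mul, mul_assoc] using this
  · have := star_conj_mem_of_mem_vnNormalizer hw (star_conj_mem_of_mem_vnNormalizer hu hx)
    simpa only [star_mul, mul_assoc] using this

theorem isStarProjection_conj {u e : H →L[ℂ] H} (hu : star u * u = 1) (he : IsStarProjection e) :
    IsStarProjection (u * e * star u) := by
  refine ⟨?_, ?_⟩
  · calc u * e * star u * (u * e * star u) = u * e * (star u * u) * e * star u := by
          simp only [mul_assoc]
      _ = u * (e * e) * star u := by rw [hu, mul_one]; simp only [mul_assoc]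
      _ = _ := by rw [he.isIdempotentElem.eq]
  · rw [isSelfAdjoint_iff]
    simp only [star_mul, star_star, he.isSelfAdjoint.star_eq, mul_assoc]

theorem IsMinimalProjection.conj {u p : H →L[ℂ] H} (hu : u ∈ vnNormalizer M N)
    (hp : IsMinimalProjection N p) : IsMinimalProjection N (u * p * star u) := by
  obtain ⟨hpN, hpp, hp0, hmin⟩ := hp
  have h1 := hu.2.1.1
  have h2 := hu.2.1.2
  have back : ∀ x : H →L[ℂ] H, star u * (u * x * star u) * u = x := fun x => by
    calc star u * (u * x * star u) * u = (star u * u) * x * (star u * u) := by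
          simp only [mul_assoc]
      _ = x := by rw [h1, one_mul, mul_one]
  have forth : ∀ x : H →L[ℂ] H, u * (star u * x * u) * star u = x := fun x => by
    calc u * (star u * x * u) * star u = (u * star u) * x * (u * star u) := by
          simp only [mul_assoc]
      _ = x := by rw [h2, one_mul, mul_one]
  refine ⟨conj_mem_of_mem_vnNormalizer hu hpN, isStarProjection_conj h1 hpp, fun h => hp0 ?_,
    fun q hq hqp hqle => ?_⟩
  · rw [← back p, h, mul_zero, zero_mul]
  · have hq' : IsStarProjection (star u * q * u) := by
      have := isStarProjection_conj (u := star u) (by rwa [star_star]) hqp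
      rwa [star_star] at this
    have hle : star u * q * u * p = star u * q * u := by
      calc star u * q * u * p = star u * q * u * p * (star u * u) := by rw [h1, mul_one]
        _ = star u * (q * (u * p * star u)) * u := by simp only [mul_assoc]
        _ = star u * q * u := by rw [hqle]
    rcases hmin _ (star_conj_mem_of_mem_vnNormalizer hu hq) hq' hle with h | h
    · left
      rw [← forth q, h, mul_zero, zero_mul]
    · right
      rw [← forth q, h]

theorem mul_eq_zero_or_eq_of_isMinimalProjection (hN : ∀ x ∈ N, ∀ y ∈ N, Commute x y)
    {e p : H →L[ℂ] H} (he : e ∈ N) (hep : IsStarProjection e) (hp : IsMinimalProjection N p) :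
    e * p = 0 ∨ e * p = p := by
  have hc := hN e he p hp.1
  refine hp.2.2.2 (e * p) (mul_mem he hp.1) (hep.mul hp.2.1 hc) ?_
  rw [mul_assoc, hp.2.1.isIdempotentElem.eq]

theorem mul_eq_zero_of_isMinimalProjection_of_ne (hN : ∀ x ∈ N, ∀ y ∈ N, Commute x y)
    {p q : H →L[ℂ] H} (hp : IsMinimalProjection N p) (hq : IsMinimalProjection N q)
    (hne : p ≠ q) : p * q = 0 := by
  rcases mul_eq_zero_or_eq_of_isMinimalProjection hN hp.1 hp.2.1 hq with h | h
  · exact h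
  rcases mul_eq_zero_or_eq_of_isMinimalProjection hN hq.1 hq.2.1 hp with h' | h'
  · rw [(hN p hp.1 q hq.1).eq, h']
  · exact absurd (by rw [← h', (hN q hq.1 p hp.1).eq, h]) hne

/-- The orbit of a projection under the normalizing unitaries. -/
def orbit (M N : VonNeumannAlgebra H) (p : H →L[ℂ] H) : Set (H →L[ℂ] H) :=
  {q | ∃ u ∈ vnNormalizer M N, q = u * p * star u}

theorem finite_orbit_of_isFiniteVN (hM : IsFiniteVN M) (hNM : N ≤ M)
    (hN : ∀ x ∈ N, ∀ y ∈ N, Commute x y) {p : H →L[ℂ] H} (hp : IsMinimalProjection N p) :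
    (orbit M N p).Finite := by
  by_contra hinf
  let φ := Set.Infinite.natEmbedding _ hinf
  let q : ℕ → H →L[ℂ] H := fun k => φ k
  have hqinj : ∀ j k, j ≠ k → q j ≠ q k := fun j k hjk h => hjk (φ.injective (Subtype.ext h))
  choose u hu hqu using fun k => (φ k).2
  have hqmin : ∀ k, IsMinimalProjection N (q k) := fun k => by
    have : q k = u k * p * star (u k) := hqu k
    rw [this]
    exact hp.conj (hu k)
  have ho : ∀ j k, j ≠ k → q j * q k = 0 := fun j k hjk =>
    mul_eq_zero_of_isMinimalProjection_of_ne hN (hqmin j) (hqmin k) (hqinj j k hjk)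
  have hex : ∀ k, ∃ t ∈ M, star t * t = 1 ∧ t * q (k + 1) = q k * t ∧
      t * (1 - q k - q (k + 1)) = 1 - q k - q (k + 1) := fun k => by
    have hw := mul_mem_vnNormalizer (hu (k + 1)) (star_mem_vnNormalizer (hu k))
    refine exists_exchange hw.1 hw.2.1.1 hw.2.1.2 (hNM (hqmin k).1) (hqmin k).2.1
      (hNM (hqmin (k + 1)).1) (hqmin (k + 1)).2.1 (ho _ _ (by omega)) (ho _ _ (by omega)) ?_
    have h1 : q k = u k * p * star (u k) := hqu k
    have h2 : q (k + 1) = u (k + 1) * p * star (u (k + 1)) := hqu (k + 1)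
    rw [h1, h2]
    calc u (k + 1) * star (u k) * (u k * p * star (u k))
        = u (k + 1) * (star (u k) * u k) * p * star (u k) := by simp only [mul_assoc]
      _ = u (k + 1) * p * (star (u (k + 1)) * u (k + 1)) * star (u k) := by
          rw [(hu k).2.1.1, (hu (k + 1)).2.1.1, mul_one, mul_one]
      _ = _ := by simp only [mul_assoc]
  choose t htM hts htq ht1 using hex
  exact (hqmin 0).2.2.1
    (eq_zero_of_exchanged_sequence hM (fun k => (hqmin k).2.1) ho htM hts htq ht1)

/-- A regular abelian subalgebra of a finite factor is diffuse or finite dimensional. -/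
theorem isDiffuse_or_finiteDimensional (hreg : IsVNRegular M N) (hM : IsFiniteVN M)
    (hfac : IsFactor M) (hN : ∀ x ∈ N, ∀ y ∈ N, Commute x y) :
    IsDiffuse N ∨ FiniteDimensional ℂ N.toStarSubalgebra := by
  by_cases hd : IsDiffuse N
  · exact .inl hd
  right
  rw [IsDiffuse] at hd
  push Not at hd
  obtain ⟨p, hp⟩ := hd
  have hfin := finite_orbit_of_isFiniteVN hM hreg.1 hN hp
  set O := hfin.toFinset with hO
  have hmemO : ∀ q, q ∈ O ↔ ∃ u ∈ vnNormalizer M N, q = u * p * star u := fun q =>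
    hfin.mem_toFinset
  have hmin : ∀ q ∈ O, IsMinimalProjection N q := fun q hq => by
    obtain ⟨u, hu, rfl⟩ := (hmemO q).1 hq
    exact hp.conj hu
  have hpO : p ∈ O := (hmemO p).2 ⟨1, one_mem_vnNormalizer, by simp⟩
  set P := ∑ q ∈ O, q with hP
  have hPN : P ∈ N := sum_mem fun q hq => (hmin q hq).1
  have hconj : ∀ u ∈ vnNormalizer M N, ∀ q ∈ O, u * q * star u ∈ O := fun u hu q hq => by
    obtain ⟨w, hw, rfl⟩ := (hmemO q).1 hq
    refine (hmemO _).2 ⟨u * w, mul_mem_vnNormalizer hu hw, ?_⟩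
    simp only [star_mul, mul_assoc]
  have hPu : ∀ u ∈ vnNormalizer M N, u * P = P * u := fun u hu => by
    have h1 : u * P * star u = P := by
      rw [hP, Finset.mul_sum, Finset.sum_mul]
      refine Finset.sum_nbij' (fun q => u * q * star u) (fun q => star u * q * u)
        (fun q hq => hconj u hu q hq) (fun q hq => ?_) (fun q _ => ?_) (fun q _ => ?_)
        (fun q _ => rfl)
      · simpa using hconj _ (star_mem_vnNormalizer hu) q hq
      · calc star u * (u * q * star u) * u = (star u * u) * q * (star u * u) := by
              simp only [mul_assoc]
          _ = q := by rw [hu.2.1.1, one_mul, mul_one]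
      · calc u * (star u * q * u) * star u = (u * star u) * q * (u * star u) := by
              simp only [mul_assoc]
          _ = q := by rw [hu.2.1.2, one_mul, mul_one]
    calc u * P = u * P * (star u * u) := by rw [hu.2.1.1, mul_one]
      _ = u * P * star u * u := by simp only [mul_assoc]
      _ = P * u := by rw [h1]
  have hPc : ∀ x ∈ M, P * x = x * P := fun x hx => by
    have hx' : x ∈ (vnNormalizer M N).centralizer.centralizer := by rw [hreg.2]; exact hx
    exact hx' P fun u hu => hPu u hu
  obtain ⟨c, hc⟩ := hfac.2 P (hreg.1 hPN) hPc
  have hPp : P * p = p := by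
    rw [hP, Finset.sum_mul, Finset.sum_eq_single p
      (fun q hq hne => mul_eq_zero_of_isMinimalProjection_of_ne hN (hmin q hq) hp hne)
      (fun h => absurd hpO h), hp.2.1.isIdempotentElem.eq]
  have hP1 : P = 1 := by
    rw [hc, smul_mul_assoc, one_mul] at hPp
    have h0 : (c - 1) • p = 0 := by rw [sub_smul, hPp, one_smul, sub_self]
    rw [hc, sub_eq_zero.1 ((smul_eq_zero.1 h0).resolve_right hp.2.2.1), one_smul]
  let W : Submodule ℂ (H →L[ℂ] H) := Submodule.span ℂ (O : Set (H →L[ℂ] H))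
  have hWfd : FiniteDimensional ℂ W := FiniteDimensional.span_finset ℂ O
  have hNW : ∀ x ∈ N, x ∈ W := fun x hx => by
    refine mem_submodule_of_projections_mem W W.closed_of_finiteDimensional
      (fun e he hep => ?_) hx
    rw [← mul_one e, ← hP1, hP, Finset.mul_sum]
    refine W.sum_mem fun q hq => ?_
    rcases mul_eq_zero_or_eq_of_isMinimalProjection hN he hep (hmin q hq) with h | h
    · rw [h]; exact W.zero_mem
    · rw [h]; exact Submodule.subset_span hq
  have hle : N.toStarSubalgebra.toSubalgebra.toSubmodule ≤ W := hNW
  exact Submodule.finiteDimensional_of_le hle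

end Minimal

end RegularInclusion

theorem proposition2p2 {A : Type*} [NonUnitalCStarAlgebra A]
    {H : Type*} [NormedAddCommGroup H] [InnerProductSpace ℂ H] [CompleteSpace H]
    (C : NonUnitalStarSubalgebra ℂ A)
    (hC : ∀ x ∈ C, ∀ y ∈ C, x * y = y * x)
    (hreg : RegularInclusion.IsCStarRegular C)
    (π : A →⋆ₙₐ[ℂ] (H →L[ℂ] H))
    (hfin : RegularInclusion.IsFiniteVN
      (RegularInclusion.bicommutant (NonUnitalStarAlgHom.range π))) :
    RegularInclusion.IsVNRegular
        (RegularInclusion.bicommutant (NonUnitalStarAlgHom.range π))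
        (RegularInclusion.bicommutant (C.map π)) ∧
      (RegularInclusion.IsTypeII1Factor
          (RegularInclusion.bicommutant (NonUnitalStarAlgHom.range π)) →
        RegularInclusion.IsDiffuse (RegularInclusion.bicommutant (C.map π)) ∨
          FiniteDimensional ℂ (RegularInclusion.bicommutant (C.map π)).toStarSubalgebra) := by
  have hvn := RegularInclusion.isVNRegular_bicommutant C hC hreg π
  refine ⟨hvn, fun hII => RegularInclusion.isDiffuse_or_finiteDimensional hvn hfin hII.1 ?_⟩
  refine Set.centralizer_centralizer_comm_of_comm ?_
  rintro _ ⟨c, hc, rfl⟩ _ ⟨d, hd, rfl⟩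
  exact (map_mul π c d).symm.trans ((congrArg π (hC c hc d hd)).trans (map_mul π d c))
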